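/- For $n\ge 1$ and $\ell\in\mathbb Z$ let $\hat Q_3(1,-1,n,\ell)$ be the link in $S^3$ obtained as the closure of the three-strand braid $(\sigma_1\sigma_2^{-1})^n(\sigma_1\sigma_2)^{3\ell}$. Its Alexander polynomial is a generator of the first elementary ideal in $\mathbb Z[t,t^{-1}]$ of the link group (all meridians being sent to $t$), normalized by $\Delta(t^{-1})=\Delta(t)$, hence unique up to sign; write $t=q^2$. Fix $\ell\in\mathbb Z$. Then for all $n\ge1$ the links $\hat Q_3(1,-1,n,\ell)$ and $\hat Q_3(1,-1,n,0)$ have normalized Alexander polynomials $$\Delta^{n,\ell}(q)=\sum_i \mu^{\ell}_{(n,i)}q^{2i},\qquad \Delta^{n,0}(q)=\sum_i \mu^{0}_{(n,i)}q^{2i},$$ and their signs can be chosen such that the following holds. (a) The two polynomials are asymptotically equal: for every $\varepsilon>0$ there is $N$ such that $|\mu^{\ell}_{(n,i)}-\mu^{0}_{(n,i)}|\le\varepsilon\,|\mu^{0}_{(n,i)}|$ for all $n\ge N$ and all $i\in\mathbb Z$. (b) There is $N\geq 1$ (depending on $\ell$) such that for all $n\ge N$ the absolute values of the coefficients of both polynomials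 are trapezoidal. That is, for $\mu_{(n,i)}=\mu^{\ell}_{(n,i)}$ and for $\mu_{(n,i)}=\mu^{0}_{(n,i)}$: $\mu_{(n,i)}=0$ for $|i|>n-1$; $|\mu_{(n,-i)}|=|\mu_{(n,i)}|$ for all $i$; and there is $0\le k\le n-1$ with $|\mu_{(n,0)}|=\dots=|\mu_{(n,k)}|$ and $|\mu_{(n,k)}|>|\mu_{(n,k+1)}|>\dots>|\mu_{(n,n-1)}|>0$. In particular $|\mu_{(n,i)}|-|\mu_{(n,i+1)}|\ge 0$ for all $i\ge 0$. -/

import Mathlib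

open scoped LaurentPolynomial

noncomputable section

namespace ClosedBraid

/-- A braid word on `k + 1` strands: the letter `(i, true)` is the generator `σ_i`, the letter
`(i, false)` is its inverse (`i = 0, …, k - 1`). -/
abbrev BraidWord (k : ℕ) := List (Fin k × Bool)

/-- The Artin action of one letter on the free group on the meridians `x_0, …, x_k`.
`σ_i` sends `x_i ↦ x_i x_{i+1} x_i⁻¹` and `x_{i+1} ↦ x_i`;
`σ_i⁻¹` sends `x_i ↦ x_{i+1}` and `x_{i+1} ↦ x_{i+1}⁻¹ x_i x_{i+1}`;
the other meridians are fixed. -/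
def artinLetter {k : ℕ} (a : Fin k × Bool) : Monoid.End (FreeGroup (Fin (k + 1))) :=
  FreeGroup.lift fun j =>
    let u : FreeGroup (Fin (k + 1)) := FreeGroup.of a.1.castSucc
    let v : FreeGroup (Fin (k + 1)) := FreeGroup.of a.1.succ
    if j = a.1.castSucc then (if a.2 then u * v * u⁻¹ else v)
    else if j = a.1.succ then (if a.2 then u else v⁻¹ * u * v)
    else FreeGroup.of j

/-- The Artin action of a braid word (multiplication of endomorphisms is composition). -/
def artin {k : ℕ} (w : BraidWord k) : Monoid.End (FreeGroup (Fin (k + 1))) :=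
  (w.map artinLetter).prod

/-- The relators `β(x_j) x_j⁻¹` of Artin's presentation
`⟨x_0, …, x_k ∣ x_j = β(x_j)⟩` of the group of the link that is the closure of the braid `β`. -/
def relator {k : ℕ} (w : BraidWord k) (j : Fin (k + 1)) : FreeGroup (Fin (k + 1)) :=
  artin w (FreeGroup.of j) * (FreeGroup.of j)⁻¹

theorem T_one_mul_T_neg_one :
    (LaurentPolynomial.T 1 : ℤ[T;T⁻¹]) * LaurentPolynomial.T (-1) = 1 := by
  rw [← LaurentPolynomial.T_add]
  exact LaurentPolynomial.T_zero

theorem T_neg_one_mul_T_one :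
    (LaurentPolynomial.T (-1) : ℤ[T;T⁻¹]) * LaurentPolynomial.T 1 = 1 := by
  rw [← LaurentPolynomial.T_add]
  exact LaurentPolynomial.T_zero

/-- The image of the generator `x_i` in the Magnus representation attached to the
`j`-th Fox derivative: the matrix with rows `(t, δ_{ij})` and `(0, 1)`. -/
def magnusGen {m : ℕ} (j i : Fin m) : (Matrix (Fin 2) (Fin 2) ℤ[T;T⁻¹])ˣ where
  val := !![LaurentPolynomial.T 1, if i = j then 1 else 0; 0, 1]
  inv := !![LaurentPolynomial.T (-1),
    -(LaurentPolynomial.T (-1) * if i = j then 1 else 0); 0, 1]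
  val_inv := by
    rw [Matrix.mul_fin_two, Matrix.one_fin_two, T_one_mul_T_neg_one, mul_neg, ← mul_assoc,
      T_one_mul_T_neg_one]
    ring_nf
  inv_val := by
    rw [Matrix.mul_fin_two, Matrix.one_fin_two, T_neg_one_mul_T_one]
    ring_nf

/-- The Magnus representation of the free group: `g` is sent to the matrix with rows
`(t ^ e(g), ∂g/∂x_j)` and `(0, 1)`, where `e(g)` is the exponent sum of `g`. -/
def magnus {m : ℕ} (j : Fin m) : FreeGroup (Fin m) →* (Matrix (Fin 2) (Fin 2) ℤ[T;T⁻¹])ˣ :=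
  FreeGroup.lift (magnusGen j)

/-- The Fox derivative `∂g/∂x_j`, evaluated in `ℤ[t, t⁻¹]` by sending every generator to `t`.
See `foxDeriv_one`, `foxDeriv_of`, `foxDeriv_mul` for the rules that determine it. -/
def foxDeriv {m : ℕ} (j : Fin m) (g : FreeGroup (Fin m)) : ℤ[T;T⁻¹] :=
  (magnus j g : Matrix (Fin 2) (Fin 2) ℤ[T;T⁻¹]) 0 1

/-- The homomorphism from the free group to the units of `ℤ[t, t⁻¹]` with `x_i ↦ t`. -/
def abelianize {m : ℕ} : FreeGroup (Fin m) →* ℤ[T;T⁻¹]ˣ :=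
  FreeGroup.lift fun _ =>
    ⟨LaurentPolynomial.T 1, LaurentPolynomial.T (-1),
      T_one_mul_T_neg_one, T_neg_one_mul_T_one⟩

theorem foxDeriv_one {m : ℕ} (j : Fin m) : foxDeriv j 1 = 0 := by
  simp [foxDeriv]

theorem foxDeriv_of {m : ℕ} (i j : Fin m) :
    foxDeriv j (FreeGroup.of i) = if i = j then 1 else 0 := by
  simp [foxDeriv, magnus, magnusGen]

theorem magnus_shape {m : ℕ} (j : Fin m) (g : FreeGroup (Fin m)) :
    (magnus j g : Matrix (Fin 2) (Fin 2) ℤ[T;T⁻¹]) 0 0 = (abelianize g : ℤ[T;T⁻¹]) ∧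
    (magnus j g : Matrix (Fin 2) (Fin 2) ℤ[T;T⁻¹]) 1 0 = 0 ∧
    (magnus j g : Matrix (Fin 2) (Fin 2) ℤ[T;T⁻¹]) 1 1 = 1 := by
  induction g using FreeGroup.induction_on with
  | C1 => simp
  | of i => simp [magnus, magnusGen, abelianize]
  | inv_of i _ =>
    simp [magnus, magnusGen, abelianize, Units.inv_mk]
  | mul a b ha hb =>
    obtain ⟨a1, a2, a3⟩ := ha
    obtain ⟨b1, b2, b3⟩ := hb
    simp [Matrix.mul_apply, Fin.sum_univ_two, a1, a2, a3, b1, b2, b3]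

theorem foxDeriv_mul {m : ℕ} (j : Fin m) (g h : FreeGroup (Fin m)) :
    foxDeriv j (g * h) = foxDeriv j g + (abelianize g : ℤ[T;T⁻¹]) * foxDeriv j h := by
  have hg := magnus_shape j g
  have hh := magnus_shape j h
  simp [foxDeriv, Matrix.mul_apply, Fin.sum_univ_two, hg.1, hh.2.2, add_comm]

/-- The Alexander matrix of the closure of a braid word: the Fox Jacobian of the presentation of
its link group, all meridians being sent to `t`. -/
def alexanderMatrix {k : ℕ} (w : BraidWord k) :
    Matrix (Fin (k + 1)) (Fin (k + 1)) ℤ[T;T⁻¹] :=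
  Matrix.of fun j i => foxDeriv i (relator w j)

/-- The Alexander ideal (first elementary ideal) of the closure of a braid word: the ideal
generated by all the minors of the Alexander matrix with one row and one column deleted. -/
def alexanderIdeal {k : ℕ} (w : BraidWord k) : Ideal ℤ[T;T⁻¹] :=
  Ideal.span (Set.range fun p : Fin (k + 1) × Fin (k + 1) =>
    ((alexanderMatrix w).submatrix p.1.succAbove p.2.succAbove).det)

/-- `D` is a symmetric Alexander polynomial of the closure of the braid word `w`: it
generates the Alexander ideal and is invariant under `t ↦ t⁻¹`. Since the units of `ℤ[t, t⁻¹]` are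
`± t ^ m`, such a `D` is unique up to sign. -/
structure IsAlexanderPolynomial {k : ℕ} (w : BraidWord k) (D : ℤ[T;T⁻¹]) : Prop where
  span_eq : Ideal.span {D} = alexanderIdeal w
  symm : ∀ i : ℤ, D.coeff (-i) = D.coeff i

/-- The word `v` repeated `n` times. -/
def wordPow {k : ℕ} (v : BraidWord k) (n : ℕ) : BraidWord k :=
  (List.replicate n v).flatten

/-- The twist `(σ₁ σ₂) ^ (3 ℓ)`. -/
def twist (ℓ : ℤ) : BraidWord 2 :=
  if 0 ≤ ℓ then wordPow [(0, true), (1, true)] (3 * ℓ.natAbs)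
  else wordPow [(1, false), (0, false)] (3 * ℓ.natAbs)

/-- The three-strand braid word `(σ₁ ^ m₁ σ₂ ^ (-m₂)) ^ n (σ₁ σ₂) ^ (3 ℓ)`, whose closure is the
twisted generalized hybrid weaving link `Q̂₃(m₁, -m₂, n, ℓ)`. -/
def weavingBraid (m₁ m₂ n : ℕ) (ℓ : ℤ) : BraidWord 2 :=
  wordPow (List.replicate m₁ (0, true) ++ List.replicate m₂ (1, false)) n ++ twist ℓ

/-- The absolute values of the coefficients of `D = ∑_{|i| ≤ d} μ_i t ^ i` are trapezoidal:
they are symmetric about `0`, constant on a plateau `|i| ≤ k`, and outside the plateau they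
decrease strictly until they vanish beyond `|i| = d`. -/
def IsTrapezoidal (D : ℤ[T;T⁻¹]) (d : ℕ) : Prop :=
  (∀ i : ℤ, |D.coeff (-i)| = |D.coeff i|) ∧
  (∀ i : ℤ, (d : ℤ) < |i| → D.coeff i = 0) ∧
  ∃ k : ℕ, k ≤ d ∧
    (∀ i : ℕ, i < k → |D.coeff ((i : ℤ) + 1)| = |D.coeff (i : ℤ)|) ∧
    (∀ i : ℕ, k ≤ i → i ≤ d → |D.coeff ((i : ℤ) + 1)| < |D.coeff (i : ℤ)|)

end ClosedBraid

end

/-!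
The Burau matrix `B` of a braid, which is the Fox Jacobian of its Artin action, fixes the constant
vectors on the right and `(1, t, …, t ^ k)` on the left. So the adjugate of the Alexander matrix
`B - 1` has rank one: all minors of `B - 1` are associated to a single one `Δ`, and
`det (reduced B - 1) = (1 + t + ⋯ + t ^ k) Δ`.

For three strands, the reduced Burau matrix of the full twist is the scalar `t ^ 3`, while that of
`σ₁ σ₂⁻¹` has determinant `1` and trace `1 - t - t⁻¹`. Hence `Δ^{n,ℓ} = P n + C`, where
`C = (t ^ (3 ℓ) + t ^ (-3 ℓ) - 2) / (t + 1 + t⁻¹)` does not depend on `n` and `P n` inherits a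
second-order recurrence from the traces of powers of a `2 × 2` matrix. By this recurrence, the
absolute values of the coefficients of `P n` decrease away from the centre, each drop between
neighbours tending to infinity with `n`. Adding the fixed polynomial `C` therefore preserves the
shape and changes each coefficient only by a vanishing proportion.
-/

noncomputable section

namespace ClosedBraid

open LaurentPolynomial Matrix

section LinearAlgebra

variable {R : Type*} [CommRing R]

theorem adjugate_apply_mul_of_vecMul_eq_zero [IsDomain R] {n : Type*} [Fintype n] [DecidableEq n]
    {A : Matrix n n R} {y : n → R} (hA : y ᵥ* A = 0) (i j j' : n) :
    A.adjugate i j * y j' = A.adjugate i j' * y j := by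
  rcases eq_or_ne y 0 with rfl | hy
  · simp
  -- Replacing column `i` of `A` by a vector orthogonal to `y` gives a matrix annihilated by `y`.
  set b : n → R := Pi.single j (y j') - Pi.single j' (y j)
  have hb : y ᵥ* A.updateCol i b = 0 := by
    rw [vecMul_updateCol, hA, Function.update_eq_self_iff, dotProduct_sub, dotProduct_single,
      dotProduct_single, mul_comm, sub_self, Pi.zero_apply]
  have hdet : (A.adjugate *ᵥ b) i = 0 := by
    rw [← cramer_eq_adjugate_mulVec, cramer_apply]
    exact exists_vecMul_eq_zero_iff.1 ⟨y, hy, hb⟩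
  simpa only [b, mulVec_sub, mulVec_single, op_smul_eq_smul, Pi.sub_apply, Pi.smul_apply, col_apply,
    smul_eq_mul, sub_eq_zero, mul_comm] using hdet

theorem adjugate_apply_mul_of_mulVec_eq_zero [IsDomain R] {n : Type*} [Fintype n] [DecidableEq n]
    {A : Matrix n n R} {x : n → R} (hA : A *ᵥ x = 0) (i i' j : n) :
    A.adjugate i j * x i' = A.adjugate i' j * x i := by
  simpa only [← adjugate_transpose, transpose_apply] using
    adjugate_apply_mul_of_vecMul_eq_zero ((vecMul_transpose A x).trans hA) j i i'

theorem adjugate_apply_of_mulVec_one_eq_zero [IsDomain R] {n : Type*} [Fintype n] [DecidableEq n]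
    {A : Matrix n n R} {y : n → R} (hrow : A *ᵥ 1 = 0) (hcol : y ᵥ* A = 0) {i₀ : n}
    (hy : y i₀ = 1) (i j : n) : A.adjugate i j = A.adjugate i₀ i₀ * y j := by
  have hi := adjugate_apply_mul_of_mulVec_eq_zero hrow i i₀ j
  have hj := adjugate_apply_mul_of_vecMul_eq_zero hcol i₀ j i₀
  rw [Pi.one_apply, Pi.one_apply, mul_one, mul_one] at hi
  rwa [hy, mul_one, ← hi] at hj

theorem det_add_vecMulVec_single {n : Type*} [Fintype n] [DecidableEq n] (A : Matrix n n R)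
    (b : n → R) (i : n) :
    (A + vecMulVec b (Pi.single i 1)).det = A.det + (A.adjugate *ᵥ b) i := by
  have hupdate : A + vecMulVec b (Pi.single i 1) = A.updateCol i (A.col i + b) := by
    ext j l
    rcases eq_or_ne l i with rfl | hl
    · simp [vecMulVec_apply]
    · simp [vecMulVec_apply, hl]
  rw [hupdate, det_updateCol_add, ← cramer_eq_adjugate_mulVec, cramer_apply]
  congr 2
  exact A.updateCol_eq_self i

variable (R) in
/-- The matrix of consecutive differences `v ↦ (v (i + 1) - v i)_i`. -/
def differenceMatrix (k : ℕ) : Matrix (Fin k) (Fin (k + 1)) R :=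
  Matrix.of fun i => Pi.single i.succ 1 - Pi.single i.castSucc 1

variable (R) in
/-- The matrix of partial sums `v ↦ (∑ l < j, v l)_j`, a right inverse of `differenceMatrix`. -/
def summationMatrix (k : ℕ) : Matrix (Fin (k + 1)) (Fin k) R :=
  Matrix.of fun j l => if l.castSucc < j then 1 else 0

theorem differenceMatrix_mul_apply {k : ℕ} {n : Type*} (M : Matrix (Fin (k + 1)) n R) (i : Fin k) :
    (differenceMatrix R k * M) i = M i.succ - M i.castSucc := by
  ext j
  simp [differenceMatrix, Matrix.mul_apply, sub_mul, Finset.sum_sub_distrib, Pi.single_apply]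

theorem differenceMatrix_mulVec_apply {k : ℕ} (v : Fin (k + 1) → R) (i : Fin k) :
    (differenceMatrix R k *ᵥ v) i = v i.succ - v i.castSucc := by
  change (Pi.single i.succ 1 - Pi.single i.castSucc 1) ⬝ᵥ v = _
  rw [sub_dotProduct, single_one_dotProduct, single_one_dotProduct]

theorem differenceMatrix_mulVec_one (k : ℕ) : differenceMatrix R k *ᵥ 1 = 0 := by
  ext i
  simp [differenceMatrix_mulVec_apply]

theorem differenceMatrix_mul_summationMatrix (k : ℕ) :
    differenceMatrix R k * summationMatrix R k = 1 := by
  ext i l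
  rw [differenceMatrix_mul_apply]
  simp only [summationMatrix, Pi.sub_apply, of_apply, Fin.castSucc_lt_succ_iff,
    Fin.castSucc_lt_castSucc_iff, one_apply]
  grind

theorem summationMatrix_mul_differenceMatrix (k : ℕ) :
    summationMatrix R k * differenceMatrix R k = 1 - vecMulVec 1 (Pi.single 0 1) := by
  ext j l
  induction j using Fin.induction with
  | zero => simp [summationMatrix, Matrix.mul_apply, one_apply, Pi.single_apply,
      eq_comm]
  | succ j ih =>
    have hsucc (m : Fin k) : summationMatrix R k j.succ m =
        summationMatrix R k j.castSucc m + (1 : Matrix (Fin k) (Fin k) R) j m := by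
      have := congrFun (congrFun (differenceMatrix_mul_summationMatrix (R := R) k) j) m
      rw [differenceMatrix_mul_apply] at this
      rw [← this]
      simp
    rw [Matrix.mul_apply] at ih ⊢
    simp only [hsucc, add_mul, Finset.sum_add_distrib, ih, ← Matrix.mul_apply, Matrix.one_mul]
    simp [differenceMatrix, one_apply, Pi.single_apply, eq_comm]

theorem det_differenceMatrix_mul_mul_summationMatrix {k : ℕ}
    {A : Matrix (Fin (k + 1)) (Fin (k + 1)) R} (hA : A *ᵥ 1 = 0) :
    (differenceMatrix R k * A * summationMatrix R k).det =
      (A + vecMulVec 1 (Pi.single 0 1)).det := by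
  set D := differenceMatrix R k
  set S := summationMatrix R k
  calc (D * A * S).det = (1 + D * ((A - 1) * S)).det := by
        rw [Matrix.sub_mul, Matrix.mul_sub, Matrix.one_mul, differenceMatrix_mul_summationMatrix,
          ← Matrix.mul_assoc, add_sub_cancel]
    _ = (1 + (A - 1) * (S * D)).det := by rw [det_one_add_mul_comm, Matrix.mul_assoc]
    _ = _ := by
        rw [summationMatrix_mul_differenceMatrix, Matrix.mul_sub, mul_vecMulVec, sub_mulVec, hA,
          one_mulVec, mul_one, zero_sub, neg_vecMulVec, sub_neg_eq_add, ← add_assoc,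
          add_sub_cancel]

theorem det_smul_sub_one_fin_two (M : Matrix (Fin 2) (Fin 2) R) (z : R) :
    (z • M - 1).det = z ^ 2 * M.det - z * M.trace + 1 := by
  simp only [det_fin_two, trace_fin_two, Matrix.sub_apply, Matrix.smul_apply, smul_eq_mul,
    one_fin_two, of_apply, cons_val_zero, cons_val_one]
  ring

theorem sq_eq_trace_smul_sub_det_smul_one (M : Matrix (Fin 2) (Fin 2) R) :
    M ^ 2 = M.trace • M - M.det • 1 := by
  nontriviality R
  have hCayleyHamilton := M.aeval_self_charpoly
  simp only [charpoly_fin_two, map_add, map_sub, map_mul, map_pow, Polynomial.aeval_X,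
    Polynomial.aeval_C, Algebra.algebraMap_eq_smul_one, smul_one_mul] at hCayleyHamilton
  rw [← sub_eq_zero, ← hCayleyHamilton]
  abel

theorem trace_pow_add_two_fin_two (M : Matrix (Fin 2) (Fin 2) R) (n : ℕ) :
    (M ^ (n + 2)).trace = M.trace * (M ^ (n + 1)).trace - M.det * (M ^ n).trace := by
  rw [pow_add, sq_eq_trace_smul_sub_det_smul_one, Matrix.mul_sub, Matrix.mul_smul, Matrix.mul_smul,
    ← pow_succ, mul_one, trace_sub, trace_smul, trace_smul, smul_eq_mul, smul_eq_mul]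

theorem pow_three_eq_smul_one_fin_two {M : Matrix (Fin 2) (Fin 2) R}
    {z : R} (htrace : M.trace = -z) (hdet : M.det = z ^ 2) : M ^ 3 = z ^ 3 • 1 := by
  have hsq : M ^ 2 = -z • M - z ^ 2 • 1 := by
    rw [sq_eq_trace_smul_sub_det_smul_one, htrace, hdet]
  rw [pow_succ, hsq, Matrix.sub_mul, Matrix.smul_mul, Matrix.smul_mul, ← sq, hsq, Matrix.one_mul]
  module

end LinearAlgebra

section FoxCalculus

variable {l m n : ℕ}

theorem foxDeriv_inv (j : Fin m) (g : FreeGroup (Fin m)) :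
    foxDeriv j g⁻¹ = -((abelianize g⁻¹ : ℤ[T;T⁻¹]ˣ) : ℤ[T;T⁻¹]) * foxDeriv j g := by
  have h := foxDeriv_mul j g⁻¹ g
  rw [inv_mul_cancel, foxDeriv_one] at h
  linear_combination -h

theorem abelianize_of (i : Fin m) :
    ((abelianize (FreeGroup.of i) : ℤ[T;T⁻¹]ˣ) : ℤ[T;T⁻¹]) = T 1 := by
  simp [abelianize]

theorem abelianize_of_inv (i : Fin m) :
    ((abelianize (FreeGroup.of i)⁻¹ : ℤ[T;T⁻¹]ˣ) : ℤ[T;T⁻¹]) = T (-1) := by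
  simp [abelianize, Units.inv_mk]

theorem foxDeriv_map (φ : FreeGroup (Fin m) →* FreeGroup (Fin n))
    (hφ : ∀ g, abelianize (φ g) = abelianize g) (i : Fin n) (g : FreeGroup (Fin m)) :
    foxDeriv i (φ g) = ∑ j, foxDeriv j g * foxDeriv i (φ (FreeGroup.of j)) := by
  induction g using FreeGroup.induction_on with
  | C1 => simp [foxDeriv_one]
  | of a => simp [foxDeriv_of]
  | inv_of a h =>
    rw [map_inv, foxDeriv_inv, ← map_inv, hφ, h, Finset.mul_sum]
    refine Finset.sum_congr rfl fun j _ => ?_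
    rw [foxDeriv_inv, mul_assoc]
  | mul a b ha hb =>
    rw [map_mul, foxDeriv_mul, hφ, ha, hb, Finset.mul_sum, ← Finset.sum_add_distrib]
    refine Finset.sum_congr rfl fun j _ => ?_
    rw [foxDeriv_mul, add_mul, mul_assoc]

/-- The Fox Jacobian `(∂φ(x_j)/∂x_i)_{j,i}` of a homomorphism of free groups, all generators being
sent to `t`. -/
def foxJacobian (φ : FreeGroup (Fin m) →* FreeGroup (Fin n)) : Matrix (Fin m) (Fin n) ℤ[T;T⁻¹] :=
  Matrix.of fun j i => foxDeriv i (φ (FreeGroup.of j))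

theorem foxJacobian_id : foxJacobian (MonoidHom.id (FreeGroup (Fin m))) = 1 := by
  ext1 j i
  simp [foxJacobian, foxDeriv_of, one_apply]

theorem foxJacobian_comp (φ : FreeGroup (Fin m) →* FreeGroup (Fin n))
    (hφ : ∀ g, abelianize (φ g) = abelianize g) (ψ : FreeGroup (Fin l) →* FreeGroup (Fin m)) :
    foxJacobian (φ.comp ψ) = foxJacobian ψ * foxJacobian φ := by
  ext1 j i
  exact foxDeriv_map φ hφ i (ψ (FreeGroup.of j))

end FoxCalculus

section Burau

variable {k : ℕ}

theorem abelianize_artinLetter (a : Fin k × Bool) (g : FreeGroup (Fin (k + 1))) :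
    abelianize (artinLetter a g) = abelianize g := by
  have h : (abelianize (m := k + 1)).comp (artinLetter a) = abelianize := by
    ext1 j
    have hof (i : Fin (k + 1)) : abelianize (FreeGroup.of i) = abelianize (FreeGroup.of j) :=
      Units.ext ((abelianize_of i).trans (abelianize_of j).symm)
    simp only [MonoidHom.comp_apply, artinLetter, FreeGroup.lift_apply_of]
    split_ifs <;> simp [hof]
  exact DFunLike.congr_fun h g

theorem artin_append (u v : BraidWord k) : artin (u ++ v) = artin u * artin v := by
  simp only [artin, List.map_append, List.prod_append]

theorem artin_singleton (a : Fin k × Bool) : artin [a] = artinLetter a := by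
  simp only [artin, List.map_singleton, List.prod_singleton]

theorem abelianize_artin (w : BraidWord k) (g : FreeGroup (Fin (k + 1))) :
    abelianize (artin w g) = abelianize g := by
  induction w with
  | nil => rfl
  | cons a w ih =>
    rw [← List.singleton_append, artin_append, artin_singleton, Monoid.End.coe_mul,
      Function.comp_apply, abelianize_artinLetter, ih]

/-- The unreduced Burau matrix of a braid word, an anti-homomorphism: the Fox Jacobian of the Artin
action. -/
def burau (w : BraidWord k) : Matrix (Fin (k + 1)) (Fin (k + 1)) ℤ[T;T⁻¹] :=
  foxJacobian (artin w)

theorem burau_nil : burau ([] : BraidWord k) = 1 := foxJacobian_id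

theorem burau_append (u v : BraidWord k) : burau (u ++ v) = burau v * burau u := by
  rw [burau, artin_append]
  exact foxJacobian_comp (artin u) (abelianize_artin u) (artin v)

theorem alexanderMatrix_eq (w : BraidWord k) : alexanderMatrix w = burau w - 1 := by
  ext1 j i
  change foxDeriv i (artin w (FreeGroup.of j) * (FreeGroup.of j)⁻¹) =
    foxDeriv i (artin w (FreeGroup.of j)) - (1 : Matrix _ _ ℤ[T;T⁻¹]) j i
  rw [foxDeriv_mul, foxDeriv_inv, abelianize_artin, abelianize_of, abelianize_of_inv, foxDeriv_of,
    one_apply]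
  linear_combination -(if j = i then 1 else 0) * T_one_mul_T_neg_one

/-- The column vector of the rank-one matrix by which the Burau matrix of a letter differs from
the identity, see `burau_singleton`. -/
def burauVector (a : Fin k × Bool) : Fin (k + 1) → ℤ[T;T⁻¹] :=
  if a.2 then Pi.single a.1.castSucc (T 1) - Pi.single a.1.succ 1
  else Pi.single a.1.castSucc 1 - Pi.single a.1.succ (T (-1))

theorem burau_singleton (a : Fin k × Bool) :
    burau [a] = 1 + vecMulVec (burauVector a) (differenceMatrix ℤ[T;T⁻¹] k a.1) := by
  obtain ⟨c, b⟩ := a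
  have hT := T_one_mul_T_neg_one
  have hne : c.succ ≠ c.castSucc := Fin.castSucc_lt_succ.ne'
  ext1 j i
  simp only [burau, artin_singleton, foxJacobian, of_apply, artinLetter, FreeGroup.lift_apply_of,
    Matrix.add_apply, vecMulVec_apply, differenceMatrix, burauVector, one_apply]
  rcases eq_or_ne j c.castSucc with rfl | hc
  · cases b <;>
      simp only [Bool.false_eq_true, if_true, if_false, foxDeriv_mul, foxDeriv_inv, foxDeriv_of,
        map_mul, Units.val_mul, abelianize_of, abelianize_of_inv, Pi.sub_apply, Pi.single_apply,
        hne.symm, eq_comm (a := i)]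
    · ring
    · linear_combination -(T 1 * if c.castSucc = i then 1 else 0) * hT
  rcases eq_or_ne j c.succ with rfl | hs
  · cases b <;>
      simp only [Bool.false_eq_true, if_true, if_false, foxDeriv_mul, foxDeriv_inv, foxDeriv_of,
        map_mul, Units.val_mul, abelianize_of, abelianize_of_inv, Pi.sub_apply, Pi.single_apply,
        hne, eq_comm (a := i)]
    · linear_combination (if c.succ = i then 1 else 0) * hT
    · ring
  cases b <;> simp [foxDeriv_of, hc, hs]

theorem burau_mulVec_one (w : BraidWord k) : burau w *ᵥ 1 = 1 := by
  induction w with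
  | nil => rw [burau_nil, one_mulVec]
  | cons a w ih =>
    have hrow : differenceMatrix ℤ[T;T⁻¹] k a.1 ⬝ᵥ 1 = 0 :=
      congrFun (differenceMatrix_mulVec_one k) a.1
    rw [← List.singleton_append, burau_append, ← mulVec_mulVec, burau_singleton, add_mulVec,
      vecMulVec_mulVec, hrow, one_mulVec, MulOpposite.op_zero, zero_smul, add_zero, ih]

theorem T_vecMul_burau (w : BraidWord k) :
    (fun i : Fin (k + 1) => T (i : ℤ)) ᵥ* burau w = fun i : Fin (k + 1) => T (i : ℤ) := by
  induction w with
  | nil => rw [burau_nil, vecMul_one]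
  | cons a w ih =>
    have hcol : (fun i : Fin (k + 1) => (T (i : ℤ) : ℤ[T;T⁻¹])) ⬝ᵥ burauVector a = 0 := by
      rw [burauVector]
      split_ifs <;>
        rw [dotProduct_sub, dotProduct_single, dotProduct_single, Fin.val_castSucc, Fin.val_succ,
          mul_one, ← T_add, Nat.cast_succ]
      · rw [sub_self]
      · rw [add_neg_cancel_right, sub_self]
    rw [← List.singleton_append, burau_append, ← vecMul_vecMul, ih, burau_singleton, vecMul_add,
      vecMul_vecMulVec, hcol, vecMul_one, zero_smul, add_zero]

/-- The reduced Burau matrix of a braid word, an anti-homomorphism: the matrix that the Burau matrix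
induces on consecutive differences. -/
def reducedBurau (w : BraidWord k) : Matrix (Fin k) (Fin k) ℤ[T;T⁻¹] :=
  differenceMatrix ℤ[T;T⁻¹] k * burau w * summationMatrix ℤ[T;T⁻¹] k

theorem reducedBurau_nil : reducedBurau ([] : BraidWord k) = 1 := by
  rw [reducedBurau, burau_nil, Matrix.mul_one, differenceMatrix_mul_summationMatrix]

theorem reducedBurau_mul_differenceMatrix (w : BraidWord k) :
    reducedBurau w * differenceMatrix ℤ[T;T⁻¹] k = differenceMatrix ℤ[T;T⁻¹] k * burau w := by
  rw [reducedBurau, Matrix.mul_assoc, summationMatrix_mul_differenceMatrix, Matrix.mul_sub,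
    mul_vecMulVec, ← mulVec_mulVec, burau_mulVec_one, differenceMatrix_mulVec_one, zero_vecMulVec,
    sub_zero, Matrix.mul_one]

theorem reducedBurau_append (u v : BraidWord k) :
    reducedBurau (u ++ v) = reducedBurau v * reducedBurau u := by
  rw [reducedBurau, burau_append, ← Matrix.mul_assoc, ← reducedBurau_mul_differenceMatrix,
    Matrix.mul_assoc, Matrix.mul_assoc, reducedBurau.eq_def u, ← Matrix.mul_assoc _ (burau u)]

theorem reducedBurau_wordPow (v : BraidWord k) (n : ℕ) :
    reducedBurau (wordPow v n) = reducedBurau v ^ n := by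
  induction n with
  | zero => exact reducedBurau_nil
  | succ n ih =>
    rw [wordPow, List.replicate_succ, List.flatten_cons, ← wordPow, reducedBurau_append, ih,
      pow_succ]

theorem reducedBurau_singleton (a : Fin k × Bool) :
    reducedBurau [a] =
      1 + vecMulVec (differenceMatrix ℤ[T;T⁻¹] k *ᵥ burauVector a) (Pi.single a.1 1) := by
  have hrow : differenceMatrix ℤ[T;T⁻¹] k a.1 ᵥ* summationMatrix ℤ[T;T⁻¹] k = Pi.single a.1 1 := by
    ext j
    rw [← mul_apply_eq_vecMul, differenceMatrix_mul_summationMatrix, one_apply, Pi.single_apply]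
    simp only [eq_comm]
  rw [reducedBurau, burau_singleton, Matrix.mul_add, Matrix.add_mul, Matrix.mul_one,
    differenceMatrix_mul_summationMatrix, mul_vecMulVec, vecMulVec_mul, hrow]

theorem alexanderMatrix_mulVec_one (w : BraidWord k) : alexanderMatrix w *ᵥ 1 = 0 := by
  rw [alexanderMatrix_eq, sub_mulVec, burau_mulVec_one, one_mulVec, sub_self]

theorem T_vecMul_alexanderMatrix (w : BraidWord k) :
    (fun i : Fin (k + 1) => T (i : ℤ)) ᵥ* alexanderMatrix w = 0 := by
  rw [alexanderMatrix_eq, vecMul_sub, T_vecMul_burau, vecMul_one, sub_self]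

theorem det_alexanderMatrix (w : BraidWord k) : (alexanderMatrix w).det = 0 :=
  exists_mulVec_eq_zero_iff.1 ⟨1, one_ne_zero, alexanderMatrix_mulVec_one w⟩

theorem adjugate_alexanderMatrix_apply (w : BraidWord k) (i j : Fin (k + 1)) :
    (alexanderMatrix w).adjugate i j = (alexanderMatrix w).adjugate 0 0 * T (j : ℤ) :=
  adjugate_apply_of_mulVec_one_eq_zero (alexanderMatrix_mulVec_one w) (T_vecMul_alexanderMatrix w)
    T_zero i j

theorem det_reducedBurau_sub_one (w : BraidWord k) :
    (reducedBurau w - 1).det =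
      (∑ i : Fin (k + 1), T (i : ℤ)) * (alexanderMatrix w).adjugate 0 0 := by
  have hconj : reducedBurau w - 1 =
      differenceMatrix ℤ[T;T⁻¹] k * alexanderMatrix w * summationMatrix ℤ[T;T⁻¹] k := by
    rw [alexanderMatrix_eq, Matrix.mul_sub, Matrix.sub_mul, Matrix.mul_one,
      differenceMatrix_mul_summationMatrix, reducedBurau]
  calc (reducedBurau w - 1).det
      = (alexanderMatrix w + vecMulVec 1 (Pi.single 0 1)).det := by
        rw [hconj, det_differenceMatrix_mul_mul_summationMatrix (alexanderMatrix_mulVec_one w)]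
    _ = ∑ j, (alexanderMatrix w).adjugate 0 j := by
        rw [det_add_vecMulVec_single, det_alexanderMatrix, zero_add]
        exact dotProduct_one _
    _ = _ := by
        rw [mul_comm, Finset.mul_sum]
        exact Finset.sum_congr rfl fun j _ => adjugate_alexanderMatrix_apply w 0 j

theorem alexanderIdeal_eq_span_adjugate (w : BraidWord k) :
    alexanderIdeal w = Ideal.span {(alexanderMatrix w).adjugate 0 0} := by
  have hminor (p q : Fin (k + 1)) :
      Associated ((alexanderMatrix w).submatrix p.succAbove q.succAbove).det
        ((alexanderMatrix w).adjugate 0 0) := by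
    have h := adjugate_fin_succ_eq_det_submatrix (alexanderMatrix w) q p
    rw [adjugate_alexanderMatrix_apply] at h
    exact (associated_unit_mul_right _ _ ((isUnit_one.neg).pow _)).trans
      (.trans (.of_eq h.symm) (associated_mul_unit_left _ _ (isUnit_T _)))
  apply le_antisymm
  · rw [alexanderIdeal, Ideal.span_le]
    rintro _ ⟨⟨p, q⟩, rfl⟩
    exact Ideal.mem_span_singleton.2 (hminor p q).symm.dvd
  · rw [Ideal.span_singleton_le_iff_mem]
    exact Ideal.mem_of_dvd _ (hminor 0 0).dvd (Ideal.subset_span ⟨(0, 0), rfl⟩)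

theorem sum_T_ne_zero (k : ℕ) : (∑ i : Fin (k + 1), T (i : ℤ) : ℤ[T;T⁻¹]) ≠ 0 := by
  intro h
  have hcard : (k + 1 : ℤ) = 0 := by simpa using congrArg (eval₂ (RingHom.id ℤ) 1) h
  lia

theorem span_eq_alexanderIdeal {w : BraidWord k} {D : ℤ[T;T⁻¹]}
    (hD : Associated ((∑ i : Fin (k + 1), T (i : ℤ)) * D) (reducedBurau w - 1).det) :
    Ideal.span {D} = alexanderIdeal w := by
  rw [alexanderIdeal_eq_span_adjugate, Ideal.span_singleton_eq_span_singleton]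
  rw [det_reducedBurau_sub_one] at hD
  exact hD.of_mul_left (.refl _) (sum_T_ne_zero k)

end Burau

section Weaving

/-- The symmetric Alexander polynomial of the closure of `(σ₁ σ₂⁻¹) ^ n`. -/
def weavingPoly : ℕ → ℤ[T;T⁻¹]
  | 0 => 0
  | 1 => 1
  | n + 2 => (1 - T 1 - T (-1)) * weavingPoly (n + 1) - weavingPoly n + 2

theorem invert_weavingPoly (n : ℕ) : invert (weavingPoly n) = weavingPoly n := by
  induction n using Nat.twoStepInduction with
  | zero => exact map_zero _
  | one => exact map_one _
  | more n h₁ h₂ =>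
    simp only [weavingPoly, map_add, map_sub, map_mul, h₁, h₂, invert_T, map_one, map_ofNat,
      neg_neg]
    ring

theorem trace_pow_eq_weavingPoly {M : Matrix (Fin 2) (Fin 2) ℤ[T;T⁻¹]} (hdet : M.det = 1)
    (htrace : M.trace = 1 - T 1 - T (-1)) (n : ℕ) :
    (M ^ n).trace = 2 - (T 1 + 1 + T (-1)) * weavingPoly n := by
  induction n using Nat.twoStepInduction with
  | zero => simp [weavingPoly]
  | one => rw [pow_one, htrace, weavingPoly]; ring
  | more n h₁ h₂ =>
    rw [trace_pow_add_two_fin_two, h₁, h₂, hdet, htrace, weavingPoly]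
    ring

theorem reducedBurau_sigma_one : reducedBurau [((0 : Fin 2), true)] = !![-T 1, 0; 1, 1] := by
  rw [reducedBurau_singleton]
  ext1 i j
  fin_cases i <;> fin_cases j <;>
    simp [burauVector, differenceMatrix_mulVec_apply, vecMulVec_apply, ← add_sub_assoc]

theorem reducedBurau_sigma_two : reducedBurau [((1 : Fin 2), true)] = !![1, T 1; 0, -T 1] := by
  rw [reducedBurau_singleton]
  ext1 i j
  fin_cases i <;> fin_cases j <;>
    simp [burauVector, differenceMatrix_mulVec_apply, vecMulVec_apply, ← add_sub_assoc]

theorem reducedBurau_sigma_one_inv : reducedBurau [((0 : Fin 2), false)] =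
    !![-T (-1), 0; T (-1), 1] := by
  rw [reducedBurau_singleton]
  ext1 i j
  fin_cases i <;> fin_cases j <;>
    simp [burauVector, differenceMatrix_mulVec_apply, vecMulVec_apply]

theorem reducedBurau_sigma_two_inv : reducedBurau [((1 : Fin 2), false)] =
    !![1, 1; 0, -T (-1)] := by
  rw [reducedBurau_singleton]
  ext1 i j
  fin_cases i <;> fin_cases j <;>
    simp [burauVector, differenceMatrix_mulVec_apply, vecMulVec_apply]

theorem reducedBurau_twist (ℓ : ℤ) : reducedBurau (twist ℓ) = (T (3 * ℓ) : ℤ[T;T⁻¹]) • 1 := by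
  have hpos : reducedBurau [((0 : Fin 2), true), (1, true)] ^ 3 = (T 1 ^ 3 : ℤ[T;T⁻¹]) • 1 := by
    rw [← List.singleton_append, reducedBurau_append, reducedBurau_sigma_one,
      reducedBurau_sigma_two]
    apply pow_three_eq_smul_one_fin_two
    · rw [mul_fin_two, trace_fin_two_of]
      ring
    · rw [det_mul, det_fin_two_of, det_fin_two_of]
      ring
  have hneg : reducedBurau [((1 : Fin 2), false), (0, false)] ^ 3 =
      (T (-1) ^ 3 : ℤ[T;T⁻¹]) • 1 := by
    rw [← List.singleton_append, reducedBurau_append, reducedBurau_sigma_one_inv,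
      reducedBurau_sigma_two_inv]
    apply pow_three_eq_smul_one_fin_two
    · rw [mul_fin_two, trace_fin_two_of]
      ring
    · rw [det_mul, det_fin_two_of, det_fin_two_of]
      ring
  rw [twist]
  split_ifs with h
  · rw [reducedBurau_wordPow, pow_mul, hpos, smul_pow, one_pow, T_pow, T_pow]
    congr 2
    lia
  · rw [reducedBurau_wordPow, pow_mul, hneg, smul_pow, one_pow, T_pow, T_pow]
    congr 2
    lia

theorem T_one_add_one_add_T_neg_one_dvd (ℓ : ℤ) :
    (T 1 + 1 + T (-1) : ℤ[T;T⁻¹]) ∣ T (3 * ℓ) + T (-(3 * ℓ)) - 2 := by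
  wlog h : 0 ≤ ℓ generalizing ℓ
  · simpa only [mul_neg, neg_neg, add_comm] using this (-ℓ) (by lia)
  obtain ⟨m, rfl⟩ := Int.eq_ofNat_of_zero_le h
  have hT := T_one_mul_T_neg_one
  have hpow : (T (3 * (m : ℤ)) : ℤ[T;T⁻¹]) = (T 1 ^ 3) ^ m := by
    rw [T_pow, T_pow]
    congr 1
    lia
  have hinv : (T (3 * (m : ℤ)) * T (-(3 * (m : ℤ))) : ℤ[T;T⁻¹]) = 1 := by
    rw [← T_add, add_neg_cancel, T_zero]
  calc (T 1 + 1 + T (-1) : ℤ[T;T⁻¹]) ∣ T 1 ^ 3 - 1 :=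
        ⟨T 1 * (T 1 - 1), by linear_combination (1 - T 1) * hT⟩
    _ ∣ T (3 * (m : ℤ)) - 1 := hpow ▸ sub_one_dvd_pow_sub_one _ m
    _ ∣ T (3 * (m : ℤ)) + T (-(3 * (m : ℤ))) - 2 :=
        ⟨1 - T (-(3 * (m : ℤ))), by linear_combination hinv⟩

theorem det_reducedBurau_weavingBraid_sub_one (n : ℕ) (ℓ : ℤ) :
    (reducedBurau (weavingBraid 1 1 n ℓ) - 1).det =
      T (3 * ℓ) * ((T 1 + 1 + T (-1)) * weavingPoly n + (T (3 * ℓ) + T (-(3 * ℓ)) - 2)) := by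
  set M := !![1, 1; 0, -T (-1)] * !![-T 1, 0; 1, (1 : ℤ[T;T⁻¹])] with hM
  have hdet : M.det = 1 := by
    rw [hM, det_mul, det_fin_two_of, det_fin_two_of]
    linear_combination T_neg_one_mul_T_one
  have htrace : M.trace = 1 - T 1 - T (-1) := by
    rw [hM, mul_fin_two, trace_fin_two_of]
    ring
  have hword : reducedBurau (weavingBraid 1 1 n ℓ) = (T (3 * ℓ) : ℤ[T;T⁻¹]) • M ^ n := by
    rw [weavingBraid, reducedBurau_append, reducedBurau_twist, reducedBurau_wordPow,
      reducedBurau_append, List.replicate_one, List.replicate_one, reducedBurau_sigma_one,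
      reducedBurau_sigma_two_inv, Matrix.smul_mul, Matrix.one_mul]
  have hinv : (T (3 * ℓ) * T (-(3 * ℓ)) : ℤ[T;T⁻¹]) = 1 := by
    rw [← T_add, add_neg_cancel, T_zero]
  rw [hword, det_smul_sub_one_fin_two, det_pow, hdet, one_pow,
    trace_pow_eq_weavingPoly hdet htrace]
  linear_combination -hinv

theorem T_one_add_one_add_T_neg_one_ne_zero : (T 1 + 1 + T (-1) : ℤ[T;T⁻¹]) ≠ 0 := by
  intro h
  simpa using congrArg (eval₂ (RingHom.id ℤ) 1) h

theorem invert_eq_self_of_mul_eq {ℓ : ℤ} {C : ℤ[T;T⁻¹]}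
    (hC : (T 1 + 1 + T (-1)) * C = T (3 * ℓ) + T (-(3 * ℓ)) - 2) : invert C = C := by
  apply mul_left_cancel₀ T_one_add_one_add_T_neg_one_ne_zero
  have hinvert := congrArg invert hC
  simp only [map_mul, map_add, map_sub, invert_T, map_one, map_ofNat, neg_neg] at hinvert
  linear_combination hinvert - hC

theorem isAlexanderPolynomial_weavingBraid (n : ℕ) {ℓ : ℤ} {C : ℤ[T;T⁻¹]}
    (hC : (T 1 + 1 + T (-1)) * C = T (3 * ℓ) + T (-(3 * ℓ)) - 2) :
    IsAlexanderPolynomial (weavingBraid 1 1 n ℓ) (weavingPoly n + C) where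
  span_eq := by
    apply span_eq_alexanderIdeal
    have hsum : (∑ i : Fin 3, T (i : ℤ) : ℤ[T;T⁻¹]) = T 1 * (T 1 + 1 + T (-1)) := by
      have hT₂ : (T 2 : ℤ[T;T⁻¹]) = T 1 * T 1 := T_add 1 1
      rw [Fin.sum_univ_three]
      change T 0 + T 1 + T 2 = _
      rw [T_zero, hT₂]
      linear_combination -T_one_mul_T_neg_one
    rw [det_reducedBurau_weavingBraid_sub_one, hsum, ← hC, ← mul_add, mul_assoc]
    exact (associated_unit_mul_left _ _ (isUnit_T 1)).trans
      (associated_unit_mul_right _ _ (isUnit_T _))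
  symm i := by
    rw [← invert_apply, map_add, invert_eq_self_of_mul_eq hC, invert_weavingPoly]

end Weaving

open Filter

section WeavingCoeff

theorem coeff_T_mul {R : Type*} [Semiring R] (m i : ℤ) (f : R[T;T⁻¹]) :
    (T m * f).coeff i = f.coeff (i - m) := by
  rw [T, AddMonoidAlgebra.coeff_single_mul_eq_mul_coeff (i - m) fun j _ => by lia, one_mul]

/-- The coefficient of `(-t) ^ i` in `weavingPoly n`. Since the coefficients of `weavingPoly n`
alternate in sign, it is their absolute value, see `abs_coeff_weavingPoly`. -/
def weavingCoeff (n : ℕ) (i : ℤ) : ℤ := i.negOnePow * (weavingPoly n).coeff i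

theorem weavingCoeff_zero (i : ℤ) : weavingCoeff 0 i = 0 := by
  simp [weavingCoeff, weavingPoly]

theorem weavingCoeff_one (i : ℤ) : weavingCoeff 1 i = if i = 0 then 1 else 0 := by
  rw [weavingCoeff, weavingPoly, ← T_zero, T_apply]
  split_ifs <;> simp_all

theorem weavingCoeff_add_two (n : ℕ) (i : ℤ) :
    weavingCoeff (n + 2) i = weavingCoeff (n + 1) (i - 1) + weavingCoeff (n + 1) i +
      weavingCoeff (n + 1) (i + 1) - weavingCoeff n i + if i = 0 then 2 else 0 := by
  have hrec : weavingPoly (n + 2) = weavingPoly (n + 1) - T 1 * weavingPoly (n + 1)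
      - T (-1) * weavingPoly (n + 1) - weavingPoly n + C 2 := by
    rw [weavingPoly, map_ofNat]
    ring
  simp only [weavingCoeff, hrec, AddMonoidAlgebra.coeff_add, AddMonoidAlgebra.coeff_sub,
    Finsupp.add_apply, Finsupp.sub_apply, coeff_T_mul, C_apply, sub_neg_eq_add, Int.negOnePow_succ,
    Int.negOnePow_sub, Int.negOnePow_one]
  rcases eq_or_ne i 0 with rfl | hi
  · simp
    ring
  · simp [hi]
    ring

theorem weavingCoeff_neg (n : ℕ) (i : ℤ) : weavingCoeff n (-i) = weavingCoeff n i := by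
  rw [weavingCoeff, ← invert_apply, invert_weavingPoly, Int.negOnePow_neg, weavingCoeff]

theorem weavingCoeff_eq_zero (n : ℕ) (i : ℤ) (h : n ≤ |i|) : weavingCoeff n i = 0 := by
  induction n using Nat.twoStepInduction generalizing i with
  | zero => exact weavingCoeff_zero i
  | one => rw [weavingCoeff_one, if_neg (by grind)]
  | more n h₁ h₂ =>
    push_cast at h h₁ h₂
    rw [weavingCoeff_add_two, h₁ _ (by grind), h₂ _ (by grind), h₂ _ (by grind), h₂ _ (by grind),
      if_neg (by grind)]
    norm_num

/-- The drop between two consecutive absolute coefficients of `weavingPoly n`. -/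
def weavingGap (n i : ℕ) : ℤ := weavingCoeff n i - weavingCoeff n (i + 1)

theorem weavingGap_zero_left (i : ℕ) : weavingGap 0 i = 0 := by
  rw [weavingGap, weavingCoeff_zero, weavingCoeff_zero, sub_zero]

theorem weavingGap_one_left (i : ℕ) : weavingGap 1 i = if i = 0 then 1 else 0 := by
  rw [weavingGap, weavingCoeff_one, weavingCoeff_one]
  grind

theorem weavingGap_add_two_zero (n : ℕ) :
    weavingGap (n + 2) 0 = weavingGap (n + 1) 1 - weavingGap n 0 + 2 := by
  simp only [weavingGap, weavingCoeff_add_two, Nat.cast_zero, Nat.cast_one, zero_sub, zero_add,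
    weavingCoeff_neg, if_true, one_ne_zero, if_false]
  ring_nf

theorem weavingGap_add_two_succ (n i : ℕ) :
    weavingGap (n + 2) (i + 1) = weavingGap (n + 1) i + weavingGap (n + 1) (i + 1)
      + weavingGap (n + 1) (i + 2) - weavingGap n (i + 1) := by
  have h₁ : (i : ℤ) + 1 ≠ 0 := by lia
  have h₂ : (i : ℤ) + 1 + 1 ≠ 0 := by lia
  simp only [weavingGap, weavingCoeff_add_two, Nat.cast_add, Nat.cast_one, Nat.cast_ofNat, h₁, h₂,
    if_false]
  ring_nf

theorem weavingGap_nonneg_and_le (n : ℕ) :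
    (∀ i, 0 ≤ weavingGap (n + 1) i) ∧ ∀ i, weavingGap n i ≤ weavingGap (n + 1) (i + 1) := by
  induction n with
  | zero =>
    have hone (i) : 0 ≤ weavingGap 1 i := by
      rw [weavingGap_one_left]
      split_ifs <;> norm_num
    exact ⟨hone, fun i => (weavingGap_zero_left i).trans_le (hone _)⟩
  | succ n ih =>
    obtain ⟨hnonneg, hle⟩ := ih
    -- The gap `weavingGap n (i + 1)` subtracted in the recurrence is absorbed by its diagonal
    -- successor `weavingGap (n + 1) (i + 2)`.
    have hle' (i) : weavingGap (n + 1) i ≤ weavingGap (n + 2) (i + 1) := by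
      linarith [weavingGap_add_two_succ n i, hnonneg (i + 1), hle (i + 1)]
    refine ⟨fun i => ?_, hle'⟩
    cases i with
    | zero => linarith [weavingGap_add_two_zero n, hle 0]
    | succ i => exact (hnonneg i).trans (hle' i)

theorem weavingGap_le_succ_succ (n i : ℕ) : weavingGap n i ≤ weavingGap (n + 1) (i + 1) :=
  (weavingGap_nonneg_and_le n).2 i

theorem weavingGap_nonneg (n i : ℕ) : 0 ≤ weavingGap n i := by
  cases n with
  | zero => exact (weavingGap_zero_left i).ge
  | succ n => exact (weavingGap_nonneg_and_le n).1 i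

theorem weavingGap_add_le (n i : ℕ) :
    weavingGap (n + 1) i + weavingGap (n + 1) (i + 1) ≤ weavingGap (n + 2) (i + 1) := by
  linarith [weavingGap_add_two_succ n i, weavingGap_le_succ_succ n (i + 1)]

theorem two_le_weavingGap_add_two_zero (n : ℕ) : 2 ≤ weavingGap (n + 2) 0 := by
  linarith [weavingGap_add_two_zero n, weavingGap_le_succ_succ n 0]

theorem weavingGap_pos {n i : ℕ} (h : i < n) : 0 < weavingGap n i := by
  induction i generalizing n with
  | zero =>
    match n with
    | 1 => rw [weavingGap_one_left, if_pos rfl]; exact one_pos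
    | n + 2 => exact two_pos.trans_le (two_le_weavingGap_add_two_zero n)
  | succ i ih =>
    obtain ⟨m, rfl⟩ : ∃ m, n = m + 1 := ⟨n - 1, by lia⟩
    exact (ih (by lia)).trans_le (weavingGap_le_succ_succ m i)

theorem natCast_le_weavingGap_add_two_one (n : ℕ) : (n : ℤ) ≤ weavingGap (n + 2) 1 := by
  induction n with
  | zero => exact weavingGap_nonneg _ _
  | succ n ih =>
    push_cast
    linarith [weavingGap_add_le (n + 1) 0, two_le_weavingGap_add_two_zero n]

theorem weavingGap_one_le_weavingGap_zero (n : ℕ) :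
    weavingGap (n + 1) 1 ≤ weavingGap (n + 3) 0 := by
  linarith [weavingGap_add_two_zero (n + 1), weavingGap_add_two_succ n 0,
    weavingGap_le_succ_succ n 1]

theorem tendsto_weavingGap (i : ℕ) : Tendsto (fun n => weavingGap n i) atTop atTop := by
  have hone : Tendsto (fun n => weavingGap n 1) atTop atTop :=
    (tendsto_add_atTop_iff_nat 2).1
      (tendsto_atTop_mono natCast_le_weavingGap_add_two_one tendsto_natCast_atTop_atTop)
  induction i with
  | zero =>
    exact (tendsto_add_atTop_iff_nat 3).1 (tendsto_atTop_mono weavingGap_one_le_weavingGap_zero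
      ((tendsto_add_atTop_iff_nat 1).2 hone))
  | succ i ih =>
    exact (tendsto_add_atTop_iff_nat 1).1
      (tendsto_atTop_mono (fun n => weavingGap_le_succ_succ n i) ih)

theorem weavingCoeff_nonneg (n : ℕ) (i : ℤ) : 0 ≤ weavingCoeff n i := by
  have hanti : Antitone fun j : ℕ => weavingCoeff n j :=
    antitone_nat_of_succ_le fun j => by
      exact_mod_cast sub_nonneg.1 (weavingGap_nonneg n j)
  have hnat (j : ℕ) : 0 ≤ weavingCoeff n j := by
    calc 0 = weavingCoeff n (j + n : ℕ) := (weavingCoeff_eq_zero n _ (by grind)).symm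
      _ ≤ weavingCoeff n j := hanti (Nat.le_add_right j n)
  obtain ⟨j, rfl | rfl⟩ := i.eq_nat_or_neg
  · exact hnat j
  · rw [weavingCoeff_neg]
    exact hnat j

theorem abs_coeff_weavingPoly (n : ℕ) (i : ℤ) :
    |(weavingPoly n).coeff i| = weavingCoeff n i := by
  rw [← abs_of_nonneg (weavingCoeff_nonneg n i), weavingCoeff, abs_mul, Int.abs_negOnePow, one_mul]

end WeavingCoeff

section DivergentGaps

/-- A sequence of symmetric Laurent polynomials `f n`, eventually supported in `|i| < n`, whose
absolute coefficients eventually decrease strictly from `i = 0` to `i = n`, with consecutive drops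
tending to infinity. This is the asymptotic shape that survives adding a fixed symmetric Laurent
polynomial, see `HasDivergentGaps.add_const`. -/
structure HasDivergentGaps (f : ℕ → ℤ[T;T⁻¹]) : Prop where
  coeff_neg : ∀ (n : ℕ) (i : ℤ), (f n).coeff (-i) = (f n).coeff i
  coeff_eq_zero : ∀ᶠ n : ℕ in atTop, ∀ i : ℤ, n ≤ |i| → (f n).coeff i = 0
  abs_coeff_succ_lt : ∀ᶠ n : ℕ in atTop, ∀ i : ℕ, i < n →
    |(f n).coeff (i + 1)| < |(f n).coeff i|
  tendsto_gap : ∀ i : ℕ, Tendsto (fun n => |(f n).coeff i| - |(f n).coeff (i + 1)|) atTop atTop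

theorem exists_coeff_eq_zero_of_le_abs {R : Type*} [Semiring R] (C : R[T;T⁻¹]) :
    ∃ K : ℕ, ∀ i : ℤ, K ≤ |i| → C.coeff i = 0 := by
  refine ⟨C.coeff.support.sup Int.natAbs + 1, fun i hi => ?_⟩
  by_contra h
  have := Finset.le_sup (f := Int.natAbs) (Finsupp.mem_support_iff.2 h)
  rw [Int.abs_eq_natAbs] at hi
  lia

namespace HasDivergentGaps

variable {f : ℕ → ℤ[T;T⁻¹]}

theorem add_const (hf : HasDivergentGaps f) {C : ℤ[T;T⁻¹]}
    (hC : ∀ i : ℤ, C.coeff (-i) = C.coeff i) : HasDivergentGaps fun n => f n + C := by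
  have hgap (i : ℕ) : Tendsto
      (fun n => |(f n + C).coeff i| - |(f n + C).coeff (i + 1)|) atTop atTop := by
    refine tendsto_atTop_mono (fun n => ?_) (tendsto_atTop_add_const_right _
      (-(|C.coeff i| + |C.coeff (i + 1)|)) (hf.tendsto_gap i))
    rw [AddMonoidAlgebra.coeff_add, Finsupp.add_apply, Finsupp.add_apply]
    linarith [abs_add_le ((f n).coeff (i + 1)) (C.coeff (i + 1)),
      abs_sub_abs_le_abs_add ((f n).coeff i) (C.coeff i)]
  obtain ⟨K, hK⟩ := exists_coeff_eq_zero_of_le_abs C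
  refine ⟨fun n i => ?_, ?_, ?_, hgap⟩
  · rw [AddMonoidAlgebra.coeff_add, Finsupp.add_apply, Finsupp.add_apply, hf.coeff_neg, hC]
  · filter_upwards [hf.coeff_eq_zero, eventually_ge_atTop K] with n hn hKn i hi
    rw [AddMonoidAlgebra.coeff_add, Finsupp.add_apply, hn i hi, hK i (by lia), add_zero]
  · have hsmall : ∀ᶠ n in atTop, ∀ i ∈ Finset.range K,
        0 < |(f n + C).coeff i| - |(f n + C).coeff (i + 1)| :=
      (Finset.eventually_all _).2 fun i _ => (hgap i).eventually_gt_atTop 0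
    filter_upwards [hsmall, hf.abs_coeff_succ_lt] with n hn hlt i hi
    rcases lt_or_ge i K with hiK | hiK
    · exact sub_pos.1 (hn i (Finset.mem_range.2 hiK))
    · rw [AddMonoidAlgebra.coeff_add, Finsupp.add_apply, Finsupp.add_apply, hK i (by grind),
        hK (i + 1) (by grind), add_zero, add_zero]
      exact hlt i hi

theorem tendsto_abs_coeff (hf : HasDivergentGaps f) (i : ℤ) :
    Tendsto (fun n => |(f n).coeff i|) atTop atTop := by
  have hnat (j : ℕ) : Tendsto (fun n => |(f n).coeff j|) atTop atTop :=
    tendsto_atTop_mono (fun n => sub_le_self _ (abs_nonneg _)) (hf.tendsto_gap j)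
  obtain ⟨j, rfl | rfl⟩ := i.eq_nat_or_neg
  · exact hnat j
  · simpa only [hf.coeff_neg] using hnat j

theorem eventually_abs_coeff_le_mul (hf : HasDivergentGaps f) (C : ℤ[T;T⁻¹]) {ε : ℝ} (hε : 0 < ε) :
    ∀ᶠ n in atTop, ∀ i : ℤ, |(C.coeff i : ℝ)| ≤ ε * |((f n).coeff i : ℝ)| := by
  have hsupport : ∀ᶠ n in atTop, ∀ i ∈ C.coeff.support,
      |(C.coeff i : ℝ)| ≤ ε * |((f n).coeff i : ℝ)| := by
    refine (Finset.eventually_all _).2 fun i _ => ?_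
    have hlim : Tendsto (fun n => ε * |((f n).coeff i : ℝ)|) atTop atTop := by
      simp only [← Int.cast_abs]
      exact (tendsto_intCast_atTop_atTop.comp (hf.tendsto_abs_coeff i)).const_mul_atTop hε
    exact hlim.eventually_ge_atTop _
  filter_upwards [hsupport] with n hn i
  by_cases hi : C.coeff i = 0
  · rw [hi, Int.cast_zero, abs_zero]
    positivity
  · exact hn i (Finsupp.mem_support_iff.2 hi)

theorem eventually_isTrapezoidal (hf : HasDivergentGaps f) :
    ∀ᶠ n in atTop, IsTrapezoidal (f n) (n - 1) := by
  filter_upwards [hf.coeff_eq_zero, hf.abs_coeff_succ_lt, eventually_ge_atTop 1] with n hzero hlt hn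
  exact ⟨fun i => by rw [hf.coeff_neg], fun i hi => hzero i (by lia), 0, Nat.zero_le _,
    fun i hi => absurd hi (Nat.not_lt_zero i), fun i _ hi => hlt i (by lia)⟩

end HasDivergentGaps

theorem IsTrapezoidal.abs_coeff_succ_le {D : ℤ[T;T⁻¹]} {d : ℕ} (hD : IsTrapezoidal D d) (i : ℕ) :
    |D.coeff ((i : ℤ) + 1)| ≤ |D.coeff i| := by
  obtain ⟨-, hzero, k, -, hplateau, hdecreasing⟩ := hD
  rcases lt_or_ge i k with hik | hik
  · exact (hplateau i hik).le
  rcases le_or_gt i d with hid | hid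
  · exact (hdecreasing i hik hid).le
  · rw [hzero (i + 1) (by grind), abs_zero]
    exact abs_nonneg _

theorem hasDivergentGaps_weavingPoly : HasDivergentGaps weavingPoly where
  coeff_neg n i := by rw [← invert_apply, invert_weavingPoly]
  coeff_eq_zero := .of_forall fun n i hi => by
    rw [← abs_eq_zero, abs_coeff_weavingPoly, weavingCoeff_eq_zero n i hi]
  abs_coeff_succ_lt := .of_forall fun n i hi => by
    rw [abs_coeff_weavingPoly, abs_coeff_weavingPoly]
    exact sub_pos.1 (weavingGap_pos hi)
  tendsto_gap i := by
    simp only [abs_coeff_weavingPoly]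
    exact tendsto_weavingGap i

end DivergentGaps

end ClosedBraid

end

/-- The Laurent variable `T` is `t = q ^ 2`, so the coefficient of `T ^ i` is the coefficient of
`q ^ (2 i)`. For every fixed `ℓ`, "`n ≫ ℓ`" means: for all sufficiently large `n`. -/
theorem mainTheorem5 (ℓ : ℤ) :
    ∃ Δ Δ₀ : ℕ → LaurentPolynomial ℤ,
      (∀ n : ℕ, 1 ≤ n →
        ClosedBraid.IsAlexanderPolynomial (ClosedBraid.weavingBraid 1 1 n ℓ) (Δ n) ∧
        ClosedBraid.IsAlexanderPolynomial (ClosedBraid.weavingBraid 1 1 n 0) (Δ₀ n)) ∧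
      -- asymptotic equality of the coefficients, uniformly in the exponent
      (∀ ε : ℝ, 0 < ε → ∃ N : ℕ, ∀ n : ℕ, N ≤ n → ∀ i : ℤ,
        |(((Δ n).coeff i : ℤ) : ℝ) - (((Δ₀ n).coeff i : ℤ) : ℝ)|
          ≤ ε * |(((Δ₀ n).coeff i : ℤ) : ℝ)|) ∧
      -- trapezoidal behaviour for all large `n`
      (∃ N : ℕ, 1 ≤ N ∧ ∀ n : ℕ, N ≤ n →
        ClosedBraid.IsTrapezoidal (Δ n) (n - 1) ∧
        ClosedBraid.IsTrapezoidal (Δ₀ n) (n - 1) ∧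
        ∀ i : ℕ,
          0 ≤ |(Δ n).coeff (i : ℤ)| - |(Δ n).coeff ((i : ℤ) + 1)| ∧
          0 ≤ |(Δ₀ n).coeff (i : ℤ)| - |(Δ₀ n).coeff ((i : ℤ) + 1)|) := by
  open ClosedBraid Filter in
  obtain ⟨C, hC⟩ := T_one_add_one_add_T_neg_one_dvd ℓ
  have hA (n : ℕ) := isAlexanderPolynomial_weavingBraid n hC.symm
  have hA₀ (n : ℕ) := isAlexanderPolynomial_weavingBraid n (ℓ := 0) (C := 0)
    (by rw [mul_zero, mul_zero, neg_zero, LaurentPolynomial.T_zero]; norm_num)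
  simp only [add_zero] at hA₀
  have hf₀ := hasDivergentGaps_weavingPoly
  have hf : HasDivergentGaps fun n => weavingPoly n + C := hf₀.add_const fun i => by
    rw [← LaurentPolynomial.invert_apply, invert_eq_self_of_mul_eq hC.symm]
  refine ⟨fun n => weavingPoly n + C, weavingPoly, fun n _ => ⟨hA n, hA₀ n⟩, fun ε hε => ?_, ?_⟩
  · obtain ⟨N, hN⟩ := eventually_atTop.1 (hf₀.eventually_abs_coeff_le_mul C hε)
    exact ⟨N, fun n hn i => by simpa using hN n hn i⟩
  · obtain ⟨N, hN⟩ := eventually_atTop.1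
      (hf.eventually_isTrapezoidal.and hf₀.eventually_isTrapezoidal)
    refine ⟨N + 1, by lia, fun n hn => ?_⟩
    obtain ⟨htrap, htrap₀⟩ := hN n (by lia)
    exact ⟨htrap, htrap₀, fun i => ⟨sub_nonneg.2 (htrap.abs_coeff_succ_le i),
      sub_nonneg.2 (htrap₀.abs_coeff_succ_le i)⟩⟩
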